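/- Let $|0\rangle,|1\rangle$ be the standard basis of $\mathbb{C}^2$, $|\pm\rangle=(|0\rangle\pm|1\rangle)/\sqrt2$, $|i_\pm\rangle=(|0\rangle\pm i|1\rangle)/\sqrt2$, and consider the ensemble of two-qubit product states $$\mathcal S_{\mathrm{NL}_1}=\{|0\rangle_A|+\rangle_B,\ |+\rangle_A|0\rangle_B,\ |i_+\rangle_A|i_+\rangle_B\}.$$ A family of states $\rho_1,\dots,\rho_k$ is (strongly) antidistinguished by a POVM $\{\Pi_j\}_{j=1}^k$ if $\operatorname{Tr}(\rho_j\Pi_j)=0$ and $\sum_i\operatorname{Tr}(\rho_i\Pi_j)>0$ for every $j$. It is conclusively distinguished by a POVM $\{\Pi_1,\dots,\Pi_k,\Pi_?\}$ if $\operatorname{Tr}(\rho_i\Pi_j)=0$ for all $i\neq j$ and $\operatorname{Tr}(\rho_i\Pi_i)>0$ for all $i$. A family of bipartite states is locally antidistinguishable (LSAD), respectively locally conclusively distinguishable (CLSD), if this can be done by a measurement implemented by an LOCC protocol, i.e. by finitely many rounds in which one party performs a local measurement (depending on all earlier outcomes) and communicates its outcome, followed by the announcement of an answer; it is globally antidistinguishable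 if it can be done by an arbitrary POVM. Then: 1. $\mathcal S_{\mathrm{NL}_1}$ is globally antidistinguishable. 2. $\mathcal S_{\mathrm{NL}_1}$ is not locally antidistinguishable. 3. $\mathcal S_{\mathrm{NL}_1}$ is locally conclusively distinguishable. Explicitly, $\mathcal M=\{M_1=\tfrac13|1\rangle\langle1|,\ M_2=\tfrac13|-\rangle\langle-|,\ M_3=\tfrac13|i_-\rangle\langle i_-|,\ M_4=I-M_1-M_2-M_3\}$ is a POVM on $\mathbb{C}^2$, and if both parties measure $\mathcal M$ and compare their outcomes, then a suitable answer rule, which assigns the answer $|i_+\rangle|i_+\rangle$ to the outcome pair $(M_1,M_1)$, conclusively distinguishes $\mathcal S_{\mathrm{NL}_1}$. Consequently LSAD and CLSD are inequivalent: it is not true that a finite family of bipartite states is locally antidistinguishable if and only if it is locally conclusively distinguishable. -/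

import Mathlib

open scoped Matrix Kronecker ComplexOrder

noncomputable section

namespace Antidist

/-- The operator `|v⟩⟨v|`. -/
def proj {ι : Type*} (v : ι → ℂ) : Matrix ι ι ℂ :=
  Matrix.vecMulVec v (star v)

/-- The product vector `|u⟩ ⊗ |v⟩`. -/
def tensorKet {ι κ : Type*} (u : ι → ℂ) (v : κ → ℂ) : ι × κ → ℂ :=
  fun p => u p.1 * v p.2

/-- `ρ` is a density operator. -/
def IsState {ι : Type*} [Fintype ι] (ρ : Matrix ι ι ℂ) : Prop :=
  ρ.PosSemidef ∧ ρ.trace = 1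

/-- `E` is a positive operator-valued measure with outcome set `O`. -/
def IsPOVM {O ι : Type*} [Fintype O] [DecidableEq ι] (E : O → Matrix ι ι ℂ) : Prop :=
  (∀ o, (E o).PosSemidef) ∧ ∑ o, E o = 1

/-- The outcome probability `Tr(ρ E)` (a real number for positive semidefinite `ρ` and `E`). -/
def prob {ι : Type*} [Fintype ι] (ρ E : Matrix ι ι ℂ) : ℝ :=
  (Matrix.trace (ρ * E)).re

/-- The measurement `E` (strongly) antidistinguishes the states `ρ`: outcome `j` never occurs
for the state `ρ j`, and every outcome occurs with positive probability for some state. -/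
def Antidistinguishes {k : ℕ} {ι : Type*} [Fintype ι]
    (E ρ : Fin k → Matrix ι ι ℂ) : Prop :=
  (∀ j, prob (ρ j) (E j) = 0) ∧ ∀ j, 0 < ∑ i, prob (ρ i) (E j)

/-- The measurement `E` conclusively distinguishes the states `ρ`: the outcome `some j` occurs
only for the state `ρ j`, and with positive probability; `none` is the inconclusive outcome. -/
def ConclusivelyDistinguishes {k : ℕ} {ι : Type*} [Fintype ι]
    (E : Option (Fin k) → Matrix ι ι ℂ) (ρ : Fin k → Matrix ι ι ℂ) : Prop :=
  (∀ i j, i ≠ j → prob (ρ i) (E (some j)) = 0) ∧ ∀ i, 0 < prob (ρ i) (E (some i))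

/-- Two-party LOCC protocols with final answer in `O`, acting on `ℂ^m ⊗ ℂ^n`. Either the parties
stop and announce an answer, or one of them performs a local measurement with Kraus operators `K`
(the output dimension may depend on the outcome, so ancillas may be attached or discarded),
communicates the outcome, and the protocol continues depending on it. -/
inductive LOCC (O : Type) : ℕ → ℕ → Type
  | announce {m n : ℕ} (o : O) : LOCC O m n
  | alice {m n : ℕ} (r : ℕ) (d : Fin r → ℕ)
      (K : (a : Fin r) → Matrix (Fin (d a)) (Fin m) ℂ)
      (hK : ∑ a, (K a)ᴴ * K a = 1)
      (next : (a : Fin r) → LOCC O (d a) n) : LOCC O m n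
  | bob {m n : ℕ} (r : ℕ) (d : Fin r → ℕ)
      (K : (b : Fin r) → Matrix (Fin (d b)) (Fin n) ℂ)
      (hK : ∑ b, (K b)ᴴ * K b = 1)
      (next : (b : Fin r) → LOCC O m (d b)) : LOCC O m n

/-- The measurement on `ℂ^m ⊗ ℂ^n` implemented by an LOCC protocol: `P.effect o` is the operator
whose expectation in the initial state is the probability of the answer `o`. -/
def LOCC.effect {O : Type} [DecidableEq O] : {m n : ℕ} → LOCC O m n → O →
    Matrix (Fin m × Fin n) (Fin m × Fin n) ℂ
  | _, _, .announce o', o => if o' = o then 1 else 0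
  | _, n, .alice _ _ K _ next, o =>
      ∑ a, (K a ⊗ₖ (1 : Matrix (Fin n) (Fin n) ℂ))ᴴ * (next a).effect o *
        (K a ⊗ₖ (1 : Matrix (Fin n) (Fin n) ℂ))
  | m, _, .bob _ _ K _ next, o =>
      ∑ b, ((1 : Matrix (Fin m) (Fin m) ℂ) ⊗ₖ K b)ᴴ * (next b).effect o *
        ((1 : Matrix (Fin m) (Fin m) ℂ) ⊗ₖ K b)

/-- Antidistinguishability by a global measurement. -/
def GloballyAntidistinguishable {k : ℕ} {ι : Type*} [Fintype ι] [DecidableEq ι]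
    (ρ : Fin k → Matrix ι ι ℂ) : Prop :=
  ∃ E : Fin k → Matrix ι ι ℂ, IsPOVM E ∧ Antidistinguishes E ρ

/-- Antidistinguishability by LOCC. -/
def LocallyAntidistinguishable {k m n : ℕ}
    (ρ : Fin k → Matrix (Fin m × Fin n) (Fin m × Fin n) ℂ) : Prop :=
  ∃ P : LOCC (Fin k) m n, Antidistinguishes P.effect ρ

/-- Conclusive distinguishability by LOCC. -/
def LocallyConclusivelyDistinguishable {k m n : ℕ}
    (ρ : Fin k → Matrix (Fin m × Fin n) (Fin m × Fin n) ℂ) : Prop :=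
  ∃ P : LOCC (Option (Fin k)) m n, ConclusivelyDistinguishes P.effect ρ

/-- Alice measures `A`, Bob measures `B`, and they jointly answer `f a b` on outcomes `a`, `b`. -/
def productMeasurement {O : Type*} [DecidableEq O] {r s m n : ℕ}
    (A : Fin r → Matrix (Fin m) (Fin m) ℂ) (B : Fin s → Matrix (Fin n) (Fin n) ℂ)
    (f : Fin r → Fin s → O) (o : O) : Matrix (Fin m × Fin n) (Fin m × Fin n) ℂ :=
  ∑ a, ∑ b, if f a b = o then A a ⊗ₖ B b else 0

/-- `|0⟩`. -/
def ket0 : Fin 2 → ℂ := ![1, 0]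

/-- `|1⟩`. -/
def ket1 : Fin 2 → ℂ := ![0, 1]

/-- `|+⟩ = (|0⟩ + |1⟩)/√2`. -/
def ketPlus : Fin 2 → ℂ := (1 / (Real.sqrt 2 : ℂ)) • (ket0 + ket1)

/-- `|-⟩ = (|0⟩ - |1⟩)/√2`. -/
def ketMinus : Fin 2 → ℂ := (1 / (Real.sqrt 2 : ℂ)) • (ket0 - ket1)

/-- `|i₊⟩ = (|0⟩ + i|1⟩)/√2`. -/
def ketIPlus : Fin 2 → ℂ := (1 / (Real.sqrt 2 : ℂ)) • (ket0 + Complex.I • ket1)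

/-- `|i₋⟩ = (|0⟩ - i|1⟩)/√2`. -/
def ketIMinus : Fin 2 → ℂ := (1 / (Real.sqrt 2 : ℂ)) • (ket0 - Complex.I • ket1)

/-- The ensemble `{|0⟩|+⟩, |+⟩|0⟩, |i₊⟩|i₊⟩}`, as density operators. -/
def SNL1 : Fin 3 → Matrix (Fin 2 × Fin 2) (Fin 2 × Fin 2) ℂ :=
  ![proj (tensorKet ket0 ketPlus), proj (tensorKet ketPlus ket0),
    proj (tensorKet ketIPlus ketIPlus)]

/-- The qubit measurement performed by each party: `|1⟩⟨1|/3`, `|-⟩⟨-|/3`, `|i₋⟩⟨i₋|/3` and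
the complement of their sum. -/
def localM : Fin 4 → Matrix (Fin 2) (Fin 2) ℂ :=
  ![(1 / 3 : ℂ) • proj ket1, (1 / 3 : ℂ) • proj ketMinus, (1 / 3 : ℂ) • proj ketIMinus,
    1 - ((1 / 3 : ℂ) • proj ket1 + (1 / 3 : ℂ) • proj ketMinus + (1 / 3 : ℂ) • proj ketIMinus)]

end Antidist

end

open scoped Matrix Kronecker ComplexOrder

namespace Antidist

/-! LOCC effects are sums of products `A ⊗ B` of positive operators and add up to the identity. If a
product effect never occurs on a product state, one factor annihilates that party's ket, so on a
qubit it is a multiple of the projector onto `|1⟩`, `|-⟩` or `|i₋⟩`. The operator `W = 1 + X + Y +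
Z` has expectation zero in all three, so `W ⊗ W` is trace-orthogonal to every effect of a local
antidistinguishing protocol, hence to the identity; but its trace is 4
(`trace_witness_mul_eq_zero`). Globally, an explicit orthogonal basis does the job. For conclusive
discrimination, each outcome of `localM` but the last excludes one state, and two different
exclusions identify the third. Together these refute the equivalence. -/

lemma proj_apply {ι : Type*} (v : ι → ℂ) (i j : ι) : proj v i j = v i * star (v j) := rfl

lemma proj_tensorKet {ι κ : Type*} (u : ι → ℂ) (v : κ → ℂ) :
    proj (tensorKet u v) = proj u ⊗ₖ proj v := by
  ext ⟨i, j⟩ ⟨i', j'⟩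
  simp only [proj, tensorKet, Matrix.vecMulVec_apply, Pi.star_apply, star_mul',
    Matrix.kronecker_apply]
  ring

section General

variable {ι κ : Type*} [Fintype ι] [Fintype κ]

lemma proj_posSemidef (v : ι → ℂ) : (proj v).PosSemidef :=
  Matrix.posSemidef_vecMulVec_self_star v

lemma trace_proj_mul (v : ι → ℂ) (A : Matrix ι ι ℂ) :
    (proj v * A).trace = star v ⬝ᵥ A *ᵥ v := by
  rw [proj, Matrix.trace_mul_comm, Matrix.mul_vecMulVec, Matrix.trace_vecMulVec, dotProduct_comm]

lemma trace_kronecker_mul_kronecker (A A' : Matrix ι ι ℂ) (B B' : Matrix κ κ ℂ) :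
    ((A ⊗ₖ B) * (A' ⊗ₖ B')).trace = (A * A').trace * (B * B').trace := by
  rw [← Matrix.mul_kronecker_mul, Matrix.trace_kronecker]

lemma prob_add (ρ E F : Matrix ι ι ℂ) : prob ρ (E + F) = prob ρ E + prob ρ F := by
  simp [prob, mul_add]

lemma prob_sum {α : Type*} (s : Finset α) (ρ : Matrix ι ι ℂ) (E : α → Matrix ι ι ℂ) :
    prob ρ (∑ a ∈ s, E a) = ∑ a ∈ s, prob ρ (E a) := by
  simp [prob, Finset.mul_sum, Matrix.trace_sum]

lemma prob_zero (ρ : Matrix ι ι ℂ) : prob ρ 0 = 0 := by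
  simp [prob]

end General

/-! ### LOCC measurements and the separable cone -/

/-- Sums of tensor products of positive semidefinite operators. -/
def separableCone (ι κ : Type*) : AddSubmonoid (Matrix (ι × κ) (ι × κ) ℂ) :=
  AddSubmonoid.closure {M | ∃ (A : Matrix ι ι ℂ) (B : Matrix κ κ ℂ),
    A.PosSemidef ∧ B.PosSemidef ∧ M = A ⊗ₖ B}

lemma kronecker_mem_separableCone {ι κ : Type*} {A : Matrix ι ι ℂ} {B : Matrix κ κ ℂ}
    (hA : A.PosSemidef) (hB : B.PosSemidef) : A ⊗ₖ B ∈ separableCone ι κ :=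
  AddSubmonoid.subset_closure ⟨A, B, hA, hB, rfl⟩

/-- The separable cone is preserved by conjugation with product operators. -/
lemma conj_mem_separableCone {ι κ ι' κ' : Type*} [Fintype ι] [Fintype κ] [Fintype ι'] [Fintype κ']
    (K : Matrix ι ι' ℂ) (L : Matrix κ κ' ℂ) {M : Matrix (ι × κ) (ι × κ) ℂ}
    (hM : M ∈ separableCone ι κ) :
    (K ⊗ₖ L)ᴴ * M * (K ⊗ₖ L) ∈ separableCone ι' κ' := by
  induction hM using AddSubmonoid.closure_induction with
  | mem M h =>
    obtain ⟨A, B, hA, hB, rfl⟩ := h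
    rw [Matrix.conjTranspose_kronecker, ← Matrix.mul_kronecker_mul, ← Matrix.mul_kronecker_mul]
    exact kronecker_mem_separableCone (hA.conjTranspose_mul_mul_same K)
      (hB.conjTranspose_mul_mul_same L)
  | zero => simp
  | add M N _ _ hM hN =>
    rw [Matrix.mul_add, Matrix.add_mul]
    exact add_mem hM hN

/-- The measurement implemented by an LOCC protocol is separable. -/
lemma LOCC.effect_mem_separableCone {O : Type} [DecidableEq O] {m n : ℕ} (P : LOCC O m n) (o : O) :
    P.effect o ∈ separableCone (Fin m) (Fin n) := by
  induction P with
  | announce o' =>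
    rw [LOCC.effect]
    split_ifs
    · rw [← Matrix.one_kronecker_one]
      exact kronecker_mem_separableCone Matrix.PosSemidef.one Matrix.PosSemidef.one
    · exact zero_mem _
  | alice r d K hK next ih =>
    rw [LOCC.effect]
    exact sum_mem fun a _ => conj_mem_separableCone _ _ (ih a)
  | bob r d K hK next ih =>
    rw [LOCC.effect]
    exact sum_mem fun b _ => conj_mem_separableCone _ _ (ih b)

/-- The effects of an LOCC protocol sum to the identity. -/
lemma LOCC.sum_effect {O : Type} [Fintype O] [DecidableEq O] {m n : ℕ} (P : LOCC O m n) :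
    ∑ o, P.effect o = 1 := by
  induction P with
  | announce o' => simp [LOCC.effect]
  | alice r d K hK next ih =>
    simp only [LOCC.effect]
    rw [Finset.sum_comm]
    simp_rw [← Matrix.sum_mul, ← Matrix.mul_sum, ih, Matrix.mul_one,
      Matrix.conjTranspose_kronecker, ← Matrix.mul_kronecker_mul, Matrix.conjTranspose_one,
      Matrix.mul_one]
    rw [← Matrix.one_kronecker_one, ← hK]
    ext ⟨i, j⟩ ⟨i', j'⟩
    simp [Matrix.sum_apply, Finset.sum_mul]
  | bob r d K hK next ih =>
    simp only [LOCC.effect]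
    rw [Finset.sum_comm]
    simp_rw [← Matrix.sum_mul, ← Matrix.mul_sum, ih, Matrix.mul_one,
      Matrix.conjTranspose_kronecker, ← Matrix.mul_kronecker_mul, Matrix.conjTranspose_one,
      Matrix.mul_one]
    rw [← Matrix.one_kronecker_one, ← hK]
    ext ⟨i, j⟩ ⟨i', j'⟩
    simp [Matrix.sum_apply, Finset.mul_sum]

open scoped MatrixOrder Matrix.Norms.L2Operator in
/-- Local measurements followed by a comparison of the outcomes form an LOCC protocol. -/
lemma exists_effect_eq_productMeasurement {O : Type} [DecidableEq O] {r s m n : ℕ}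
    {A : Fin r → Matrix (Fin m) (Fin m) ℂ} {B : Fin s → Matrix (Fin n) (Fin n) ℂ}
    (hA : IsPOVM A) (hB : IsPOVM B) (f : Fin r → Fin s → O) :
    ∃ P : LOCC O m n, P.effect = productMeasurement A B f := by
  -- Factoring each POVM element as `Kᴴ * K` supplies the Kraus operators the protocol needs.
  have sqrtA : ∀ a, ∃ K : Matrix (Fin m) (Fin m) ℂ, A a = Kᴴ * K := fun a =>
    CStarAlgebra.nonneg_iff_eq_star_mul_self.mp (hA.1 a).nonneg
  have sqrtB : ∀ b, ∃ L : Matrix (Fin n) (Fin n) ℂ, B b = Lᴴ * L := fun b =>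
    CStarAlgebra.nonneg_iff_eq_star_mul_self.mp (hB.1 b).nonneg
  choose K hK using sqrtA
  choose L hL using sqrtB
  refine ⟨.alice r (fun _ => m) K (by simp_rw [← hK]; exact hA.2) fun a =>
    .bob s (fun _ => n) L (by simp_rw [← hL]; exact hB.2) fun b => .announce (f a b), ?_⟩
  funext o
  simp only [LOCC.effect, productMeasurement, Finset.mul_sum, Finset.sum_mul]
  refine Finset.sum_congr rfl fun a _ => Finset.sum_congr rfl fun b _ => ?_
  split_ifs
  · simp only [Matrix.conjTranspose_kronecker, Matrix.mul_one, ← Matrix.mul_kronecker_mul,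
      Matrix.conjTranspose_one, Matrix.one_mul, hK, hL]
  · simp

/-! ### Explicit qubit projectors and the ensemble -/

lemma trace_mul_fin_two (A B : Matrix (Fin 2) (Fin 2) ℂ) :
    (A * B).trace = A 0 0 * B 0 0 + A 0 1 * B 1 0 + A 1 0 * B 0 1 + A 1 1 * B 1 1 := by
  simp only [Matrix.trace_fin_two, Matrix.mul_apply, Fin.sum_univ_two]
  ring

lemma inv_sqrt_two_mul_self : ((Real.sqrt 2 : ℂ))⁻¹ * ((Real.sqrt 2 : ℂ))⁻¹ = 1 / 2 := by
  rw [← mul_inv, ← Complex.ofReal_mul, Real.mul_self_sqrt (by norm_num)]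
  norm_num

lemma proj_ket0 : proj ket0 = !![1, 0; 0, 0] := by
  ext i j; fin_cases i <;> fin_cases j <;> simp [proj_apply, ket0]

lemma proj_ket1 : proj ket1 = !![0, 0; 0, 1] := by
  ext i j; fin_cases i <;> fin_cases j <;> simp [proj_apply, ket1]

lemma proj_inv_sqrt_two_smul (v : Fin 2 → ℂ) :
    proj ((1 / (Real.sqrt 2 : ℂ)) • v) = (1 / 2 : ℂ) • proj v := by
  ext i j
  simp only [proj_apply, Pi.smul_apply, Matrix.smul_apply,
    smul_eq_mul, star_mul', one_div, star_inv₀]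
  have : star (Real.sqrt 2 : ℂ) = (Real.sqrt 2 : ℂ) := Complex.conj_ofReal _
  rw [this]
  linear_combination (v i * star (v j)) * inv_sqrt_two_mul_self

lemma proj_ketPlus : proj ketPlus = !![1/2, 1/2; 1/2, 1/2] := by
  rw [ketPlus, proj_inv_sqrt_two_smul]
  ext i j
  fin_cases i <;> fin_cases j <;> simp [proj_apply, ket0, ket1]

lemma proj_ketMinus : proj ketMinus = !![1/2, -1/2; -1/2, 1/2] := by
  rw [ketMinus, proj_inv_sqrt_two_smul]
  ext i j
  fin_cases i <;> fin_cases j <;> simp [proj_apply, ket0, ket1] <;> ring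

lemma proj_ketIPlus : proj ketIPlus = !![1/2, -Complex.I/2; Complex.I/2, 1/2] := by
  rw [ketIPlus, proj_inv_sqrt_two_smul]
  ext i j
  fin_cases i <;> fin_cases j <;> simp [proj_apply, ket0, ket1] <;> ring

lemma proj_ketIMinus : proj ketIMinus = !![1/2, Complex.I/2; -Complex.I/2, 1/2] := by
  rw [ketIMinus, proj_inv_sqrt_two_smul]
  ext i j
  fin_cases i <;> fin_cases j <;> simp [proj_apply, ket0, ket1] <;> ring

/-- Alice's parts of the states of the ensemble. -/
noncomputable def aliceKet : Fin 3 → Fin 2 → ℂ := ![ket0, ketPlus, ketIPlus]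

/-- Bob's parts of the states of the ensemble. -/
noncomputable def bobKet : Fin 3 → Fin 2 → ℂ := ![ketPlus, ket0, ketIPlus]

lemma SNL1_eq (i : Fin 3) : SNL1 i = proj (aliceKet i) ⊗ₖ proj (bobKet i) := by
  fin_cases i <;> exact proj_tensorKet _ _

lemma trace_proj_aliceKet (i : Fin 3) : (proj (aliceKet i)).trace = 1 := by
  fin_cases i <;>
    simp [aliceKet, proj_ket0, proj_ketPlus, proj_ketIPlus, Matrix.trace_fin_two] <;> norm_num

lemma trace_proj_bobKet (i : Fin 3) : (proj (bobKet i)).trace = 1 := by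
  fin_cases i <;>
    simp [bobKet, proj_ket0, proj_ketPlus, proj_ketIPlus, Matrix.trace_fin_two] <;> norm_num

lemma SNL1_isState (i : Fin 3) : IsState (SNL1 i) := by
  rw [SNL1_eq]
  refine ⟨(proj_posSemidef _).kronecker (proj_posSemidef _), ?_⟩
  rw [Matrix.trace_kronecker, trace_proj_aliceKet, trace_proj_bobKet, one_mul]

/-! ### Global antidistinguishability -/

/-- An orthogonal basis of `ℂ² ⊗ ℂ²` whose first three vectors are orthogonal to the respective
states of the ensemble, and whose last vector is orthogonal to all of them. The squared norms are
`16`, `16`, `16` and `8`. -/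
noncomputable def antiBasis : Fin 4 → Fin 2 × Fin 2 → ℂ :=
  ![fun p => !![1 - Complex.I, -1 + Complex.I; 3 + Complex.I, -1 + Complex.I] p.1 p.2,
    fun p => !![1 - Complex.I, 3 + Complex.I; -1 + Complex.I, -1 + Complex.I] p.1 p.2,
    fun p => !![3 + Complex.I, 1 - Complex.I; 1 - Complex.I, 1 - Complex.I] p.1 p.2,
    fun p => !![1, -1; -1, 1 + 2 * Complex.I] p.1 p.2]

/-- A global measurement antidistinguishing the ensemble. -/
noncomputable def antiPOVM : Fin 3 → Matrix (Fin 2 × Fin 2) (Fin 2 × Fin 2) ℂ :=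
  ![(1 / 16 : ℂ) • proj (antiBasis 0), (1 / 16 : ℂ) • proj (antiBasis 1),
    (1 / 16 : ℂ) • proj (antiBasis 2) + (1 / 8 : ℂ) • proj (antiBasis 3)]

lemma antiPOVM_isPOVM : IsPOVM antiPOVM := by
  refine ⟨fun j => ?_, ?_⟩
  · fin_cases j
    · exact (proj_posSemidef _).smul (by positivity)
    · exact (proj_posSemidef _).smul (by positivity)
    · exact ((proj_posSemidef _).smul (by positivity)).add ((proj_posSemidef _).smul (by positivity))
  · ext ⟨i, j⟩ ⟨i', j'⟩
    fin_cases i <;> fin_cases j <;> fin_cases i' <;> fin_cases j' <;>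
      simp [antiPOVM, Fin.sum_univ_three, proj_apply, antiBasis, Complex.ext_iff] <;> norm_num

/-- Each state lies in the span of the first three vectors of `antiBasis` and is spread evenly over
the two that it is not orthogonal to; the fourth vector only completes the measurement. -/
lemma prob_antiPOVM (i j : Fin 3) :
    prob (SNL1 i) (antiPOVM j) = if i = j then 0 else 1 / 2 := by
  rw [SNL1_eq]
  have hproj : ∀ v w : Fin 2 × Fin 2, (proj (aliceKet i) ⊗ₖ proj (bobKet i)) v w =
      ![!![1, 0; 0, 0], !![1/2, 1/2; 1/2, 1/2], !![1/2, -Complex.I/2; Complex.I/2, 1/2]] i v.1 w.1 *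
      ![!![1/2, 1/2; 1/2, 1/2], !![1, 0; 0, 0], !![1/2, -Complex.I/2; Complex.I/2, 1/2]] i
        v.2 w.2 := by
    intro v w
    rw [← proj_ket0, ← proj_ketPlus, ← proj_ketIPlus]
    fin_cases i <;> rfl
  simp only [prob, Matrix.trace, Matrix.diag_apply, Matrix.mul_apply, hproj]
  fin_cases i <;> fin_cases j <;>
    simp [antiPOVM, Fintype.sum_prod_type, proj_apply, antiBasis] <;> norm_num

lemma SNL1_globallyAntidistinguishable : GloballyAntidistinguishable SNL1 := by
  refine ⟨antiPOVM, antiPOVM_isPOVM, fun j => by simp [prob_antiPOVM], fun j => ?_⟩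
  fin_cases j <;> simp [prob_antiPOVM, Fin.sum_univ_three]

/-! ### No local antidistinguishability -/

/-- The operator `1 + X + Y + Z`, whose expectation vanishes in `|1⟩`, `|-⟩` and `|i₋⟩`. -/
noncomputable def pauliSum : Matrix (Fin 2) (Fin 2) ℂ := !![2, 1 - Complex.I; 1 + Complex.I, 0]

/-- A positive semidefinite qubit operator annihilating `|0⟩`, `|+⟩` or `|i₊⟩` is a multiple of
the orthogonal projector, so that its product with `1 + X + Y + Z` is traceless. -/
lemma trace_pauliSum_mul_eq_zero {A : Matrix (Fin 2) (Fin 2) ℂ} (hA : A.PosSemidef)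
    {v : Fin 2 → ℂ} (hv : v = ket0 ∨ v = ketPlus ∨ v = ketIPlus)
    (h : (proj v * A).trace = 0) : (pauliSum * A).trace = 0 := by
  have hAv : A *ᵥ v = 0 := by
    rw [trace_proj_mul] at h
    exact (hA.dotProduct_mulVec_zero_iff v).mp h
  have hH : star (A 0 1) = A 1 0 := hA.1.apply 1 0
  have h00 : star (A 0 0) = A 0 0 := hA.1.apply 0 0
  have hs : (1 / (Real.sqrt 2 : ℂ)) ≠ 0 := by simp
  have htr : (pauliSum * A).trace =
      2 * A 0 0 + (1 - Complex.I) * A 1 0 + (1 + Complex.I) * A 0 1 := by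
    rw [trace_mul_fin_two]
    simp [pauliSum]
  rw [htr]
  -- `A 1 1` is absent from the trace because the lower right entry of `pauliSum` is zero. For
  -- `ketPlus` and `ketIPlus`, row 0 of `A *ᵥ v = 0` and hermiticity therefore suffice.
  rcases hv with rfl | rfl | rfl
  · have h0 := congrFun hAv 0
    have h1 := congrFun hAv 1
    simp [ket0, Matrix.mulVec, dotProduct, Fin.sum_univ_two] at h0 h1
    have h01 : A 0 1 = 0 := by
      rw [← star_eq_zero, hH, h1]
    simp [h0, h1, h01]
  · rw [ketPlus, Matrix.mulVec_smul, smul_eq_zero_iff_right hs] at hAv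
    have h0 := congrFun hAv 0
    simp [ket0, ket1, Matrix.mulVec, dotProduct, Fin.sum_univ_two] at h0
    have h01 : A 0 1 = -A 0 0 := by linear_combination h0
    have h10 : A 1 0 = -A 0 0 := by rw [← hH, h01, star_neg, h00]
    rw [h01, h10]
    ring
  · rw [ketIPlus, Matrix.mulVec_smul, smul_eq_zero_iff_right hs] at hAv
    have h0 := congrFun hAv 0
    simp [ket0, ket1, Matrix.mulVec, dotProduct, Fin.sum_univ_two] at h0
    have h01 : A 0 1 = Complex.I * A 0 0 := by
      linear_combination -Complex.I * h0 + A 0 1 * Complex.I_mul_I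
    have h10 : A 1 0 = -Complex.I * A 0 0 := by
      rw [← hH, h01, star_mul', h00]
      simp
    rw [h01, h10]
    linear_combination 2 * A 0 0 * Complex.I_mul_I

lemma aliceKet_cases (j : Fin 3) :
    aliceKet j = ket0 ∨ aliceKet j = ketPlus ∨ aliceKet j = ketIPlus := by
  fin_cases j <;> simp [aliceKet]

lemma bobKet_cases (j : Fin 3) :
    bobKet j = ket0 ∨ bobKet j = ketPlus ∨ bobKet j = ketIPlus := by
  fin_cases j <;> simp [bobKet]

/-- Separable effects have nonnegative probabilities, and those that never occur for a given state
of the ensemble are orthogonal to the witness `(1 + X + Y + Z) ⊗ (1 + X + Y + Z)`. -/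
lemma trace_witness_mul_eq_zero (j : Fin 3) {M : Matrix (Fin 2 × Fin 2) (Fin 2 × Fin 2) ℂ}
    (hM : M ∈ separableCone (Fin 2) (Fin 2)) :
    0 ≤ prob (SNL1 j) M ∧
      (prob (SNL1 j) M = 0 → ((pauliSum ⊗ₖ pauliSum) * M).trace = 0) := by
  induction hM using AddSubmonoid.closure_induction with
  | mem M h =>
    obtain ⟨A, B, hA, hB, rfl⟩ := h
    have hpos : 0 ≤ (proj (aliceKet j) * A).trace * (proj (bobKet j) * B).trace := by
      rw [trace_proj_mul, trace_proj_mul]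
      exact mul_nonneg (hA.dotProduct_mulVec_nonneg _) (hB.dotProduct_mulVec_nonneg _)
    rw [prob, SNL1_eq, trace_kronecker_mul_kronecker, trace_kronecker_mul_kronecker]
    refine ⟨(Complex.nonneg_iff.mp hpos).1, fun h => ?_⟩
    -- `prob` only records the real part; nonnegativity in `ℂ` makes the imaginary part vanish as
    -- well.
    have hz : (proj (aliceKet j) * A).trace * (proj (bobKet j) * B).trace = 0 :=
      Complex.ext h (Complex.nonneg_iff.mp hpos).2.symm
    rcases mul_eq_zero.mp hz with h | h
    · rw [trace_pauliSum_mul_eq_zero hA (aliceKet_cases j) h, zero_mul]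
    · rw [trace_pauliSum_mul_eq_zero hB (bobKet_cases j) h, mul_zero]
  | zero => simp [prob_zero]
  | add M N _ _ hM hN =>
    rw [prob_add]
    refine ⟨add_nonneg hM.1 hN.1, fun h => ?_⟩
    obtain ⟨h₁, h₂⟩ := (add_eq_zero_iff_of_nonneg hM.1 hN.1).mp h
    rw [Matrix.mul_add, Matrix.trace_add, hM.2 h₁, hN.2 h₂, add_zero]

lemma SNL1_not_locallyAntidistinguishable : ¬ LocallyAntidistinguishable SNL1 := by
  rintro ⟨P, hP, -⟩
  have h : ((pauliSum ⊗ₖ pauliSum) * ∑ j, P.effect j).trace = 0 := by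
    rw [Finset.mul_sum, Matrix.trace_sum]
    exact Finset.sum_eq_zero fun j _ =>
      (trace_witness_mul_eq_zero j (P.effect_mem_separableCone j)).2 (hP j)
  rw [P.sum_effect, Matrix.mul_one, Matrix.trace_kronecker] at h
  simp [pauliSum, Matrix.trace_fin_two] at h

/-! ### Local conclusive distinguishability -/

/-- The identity is one third of the sum of three resolutions `|v⟩⟨v| + |v⊥⟩⟨v⊥|`, and the other
outcomes take the `v⊥` terms. This form makes positivity visible. -/
lemma localM_three : localM 3 =
    (1 / 3 : ℂ) • proj ket0 + (1 / 3 : ℂ) • proj ketPlus + (1 / 3 : ℂ) • proj ketIPlus := by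
  simp only [localM, proj_ket0, proj_ket1, proj_ketPlus, proj_ketMinus, proj_ketIPlus,
    proj_ketIMinus]
  ext i j
  fin_cases i <;> fin_cases j <;> simp <;> ring

lemma localM_isPOVM : IsPOVM localM := by
  have hp : ∀ v : Fin 2 → ℂ, ((1 / 3 : ℂ) • proj v).PosSemidef := fun v =>
    (proj_posSemidef v).smul (by positivity)
  refine ⟨fun a => ?_, ?_⟩
  · fin_cases a
    · exact hp _
    · exact hp _
    · exact hp _
    · change (localM 3).PosSemidef
      rw [localM_three]
      exact ((hp _).add (hp _)).add (hp _)
  · rw [Fin.sum_univ_four]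
    simp only [localM, Matrix.cons_val]
    abel

/-- The answer rule: outcomes `0`, `1`, `2` of Alice exclude the states `0`, `1`, `2`, those of Bob
exclude the states `1`, `0`, `2`; an answer is given when two states are excluded. -/
def answerRule : Fin 4 → Fin 4 → Option (Fin 3) :=
  ![![some 2, none, some 1, none], ![none, some 2, some 0, none],
    ![some 0, some 1, none, none], ![none, none, none, none]]

/-- The zeros mark the excluded states; the other entries are `1/3 · 1/2` and `1/3 · (1 + 1/2 +
1/2)`. -/
lemma trace_aliceKet_localM (i : Fin 3) (a : Fin 4) :
    (proj (aliceKet i) * localM a).trace =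
      !![0, 1/6, 1/6, 2/3; 1/6, 0, 1/6, 2/3; 1/6, 1/6, 0, 2/3] i a := by
  rw [trace_mul_fin_two]
  fin_cases i <;> fin_cases a <;>
    simp [aliceKet, localM, proj_ket0, proj_ket1, proj_ketPlus, proj_ketMinus, proj_ketIPlus,
      proj_ketIMinus, Complex.ext_iff] <;> norm_num

lemma trace_bobKet_localM (i : Fin 3) (b : Fin 4) :
    (proj (bobKet i) * localM b).trace =
      !![1/6, 0, 1/6, 2/3; 0, 1/6, 1/6, 2/3; 1/6, 1/6, 0, 2/3] i b := by
  rw [trace_mul_fin_two]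
  fin_cases i <;> fin_cases b <;>
    simp [bobKet, localM, proj_ket0, proj_ket1, proj_ketPlus, proj_ketMinus, proj_ketIPlus,
      proj_ketIMinus, Complex.ext_iff] <;> norm_num

lemma prob_productMeasurement_localM (i j : Fin 3) :
    prob (SNL1 i) (productMeasurement localM localM answerRule (some j)) =
      -- Each conclusive answer comes from two outcome pairs, each of probability `1/6 · 1/6` on the
      -- right state.
      if i = j then 1 / 18 else 0 := by
  have key : ∀ a b, prob (SNL1 i) (if answerRule a b = some j then localM a ⊗ₖ localM b else 0) =
      if answerRule a b = some j then ((proj (aliceKet i) * localM a).trace *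
        (proj (bobKet i) * localM b).trace).re else 0 := by
    intro a b
    split_ifs
    · rw [prob, SNL1_eq, trace_kronecker_mul_kronecker]
    · exact prob_zero _
  simp only [productMeasurement, prob_sum, key, trace_aliceKet_localM, trace_bobKet_localM]
  fin_cases i <;> fin_cases j <;>
    simp [answerRule, Fin.sum_univ_four] <;> norm_num

lemma conclusivelyDistinguishes_localM :
    ConclusivelyDistinguishes (productMeasurement localM localM answerRule) SNL1 :=
  ⟨fun i j hij => by rw [prob_productMeasurement_localM, if_neg hij],
    fun i => by rw [prob_productMeasurement_localM, if_pos rfl]; norm_num⟩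

lemma SNL1_locallyConclusivelyDistinguishable : LocallyConclusivelyDistinguishable SNL1 := by
  obtain ⟨P, hP⟩ := exists_effect_eq_productMeasurement localM_isPOVM localM_isPOVM answerRule
  exact ⟨P, hP ▸ conclusivelyDistinguishes_localM⟩

end Antidist

theorem mainTheorem5 :
    Antidist.GloballyAntidistinguishable Antidist.SNL1 ∧
    ¬ Antidist.LocallyAntidistinguishable Antidist.SNL1 ∧
    Antidist.LocallyConclusivelyDistinguishable Antidist.SNL1 ∧
    (Antidist.IsPOVM Antidist.localM ∧
      ∃ f : Fin 4 → Fin 4 → Option (Fin 3),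
        f 0 0 = some 2 ∧
        Antidist.ConclusivelyDistinguishes
          (Antidist.productMeasurement Antidist.localM Antidist.localM f) Antidist.SNL1) ∧
    ¬ (∀ (k m n : ℕ) (ρ : Fin k → Matrix (Fin m × Fin n) (Fin m × Fin n) ℂ),
        (∀ i, Antidist.IsState (ρ i)) →
        (Antidist.LocallyAntidistinguishable ρ ↔
          Antidist.LocallyConclusivelyDistinguishable ρ)) :=
  ⟨Antidist.SNL1_globallyAntidistinguishable,
    Antidist.SNL1_not_locallyAntidistinguishable,
    Antidist.SNL1_locallyConclusivelyDistinguishable,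
    ⟨Antidist.localM_isPOVM, Antidist.answerRule, rfl, Antidist.conclusivelyDistinguishes_localM⟩,
    fun h => Antidist.SNL1_not_locallyAntidistinguishable
      ((h 3 2 2 _ Antidist.SNL1_isState).mpr Antidist.SNL1_locallyConclusivelyDistinguishable)⟩
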